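/- Fix an integer $s\ge 2$. The semi-random $s$-uniform hypergraph process with $r=1$ on the vertex set $[n]=\{1,\dots,n\}$ ($n\ge 1$) starts from the empty hypergraph $H_0$. In each round $t\ge 1$ a vertex $u_t\in[n]$ is chosen uniformly at random, independently of the past; the player, who knows the history of the process and $u_t$, then selects a set $V_t\subseteq[n]$ with $|V_t|=s-1$, and the edge $\{u_t\}\cup V_t$, regarded as a multiset of size $s$, is added to $H_{t-1}$ to form $H_t$. Parallel edges and $u_t\in V_t$ are allowed. A strategy $\mathcal S$ on $[n]$ prescribes, for every $t$ and every history $(u_1,V_1,\dots,u_{t-1},V_{t-1},u_t)$, a probability distribution from which $V_t$ is drawn. For a fixed finite (simple) $s$-uniform hypergraph $G$ let $\mathcal P_G$ be the property that $H_t$ contains a copy of $G$, that is, that there is an injection $V(G)\to[n]$ which maps every edge of $G$ to an edge of $H_t$. For $0<q<1$ let $\tau_{\mathcal P_G}(\mathcal S,q,n)$ be the least $t\ge 0$ with $\mathbb P[H_t\in\mathcal P_G]\ge q$ when the player follows $\mathcal S$ (and $\infty$ if there is no such $t$), let $\tau_{\mathcal P_G}(q,n)=\inf_{\mathcal S}\tau_{\mathcal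 P_G}(\mathcal S,q,n)$, the infimum being over all strategies on $[n]$, and let $$\tau_{\mathcal P_G}=\lim_{q\to1^-}\ \limsup_{n\to\infty}\frac{\ln\tau_{\mathcal P_G}(q,n)}{\ln n}.$$ The hypergraph $G$ is $d$-degenerate if every sub-hypergraph of $G$ with a non-empty vertex set has a vertex of degree at most $d$ in that sub-hypergraph, and the degeneracy of $G$ is the smallest $d$ for which $G$ is $d$-degenerate. Corollary. Let $G$ be a fixed $s$-uniform hypergraph, $s\ge2$, of degeneracy $d\ge 1$. Then the limit defining $\tau_{\mathcal P_G}$ exists and $$\tau_{\mathcal P_G}=\frac{d-1}{d}.$$ -/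

import Mathlib

open Filter Topology

noncomputable section

/-! ### Uniform hypergraphs and degeneracy -/

/-- A (simple, finite) `s`-uniform hypergraph on the vertex set `V`:
a finite set of edges, each of them an `s`-element subset of `V`. -/
structure UniformHypergraph (V : Type*) (s : ℕ) where
  edges : Finset (Finset V)
  card_edge : ∀ e ∈ edges, e.card = s

namespace UniformHypergraph

variable {V : Type*} [DecidableEq V] {s : ℕ}

/-- `G` is `d`-degenerate: every sub-hypergraph `(W, F)` of `G`, where `W` is a nonempty vertex
set and `F` is a set of edges of `G` that are contained in `W`, has minimum degree at most `d`. -/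
def IsDegenerate (G : UniformHypergraph V s) (d : ℕ) : Prop :=
  ∀ (W : Finset V) (F : Finset (Finset V)), W.Nonempty → F ⊆ G.edges → (∀ e ∈ F, e ⊆ W) →
    ∃ v ∈ W, (F.filter fun e => v ∈ e).card ≤ d

/-- The degeneracy of `G`: the smallest `d` for which `G` is `d`-degenerate. -/
def degeneracy (G : UniformHypergraph V s) : ℕ :=
  sInf {d | G.IsDegenerate d}

end UniformHypergraph

/-! ### The semi-random hypergraph process with one random vertex per round -/

/-- A hypergraph on `[n]` in which parallel edges are allowed and an edge may contain a vertex
several times: a multiset of edges, every edge being a multiset of vertices. -/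
abbrev MultiHypergraph (n : ℕ) : Type := Multiset (Multiset (Fin n))

namespace SemiRandom

/-- A reply of the player: a set of `s - 1` vertices. -/
abbrev Reply (n s : ℕ) : Type := {A : Finset (Fin n) // A.card + 1 = s}

/-- The history of the process: the list of all pairs (random vertex, reply) so far, the most
recent round first. -/
abbrev History (n s : ℕ) : Type := List (Fin n × Reply n s)

/-- The edge `{u} ∪ A`, as a multiset: the vertex `u` counts twice if it lies in `A`. -/
def edge {n s : ℕ} (m : Fin n × Reply n s) : Multiset (Fin n) :=
  m.1 ::ₘ m.2.1.val

/-- The hypergraph built by the rounds of a history. -/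
def graph {n s : ℕ} (h : History n s) : MultiHypergraph n :=
  (h.map edge : List (Multiset (Fin n)))

/-- A (possibly randomised) strategy on `[n]`: given the history of the process and the vertex
presented in the current round, a probability distribution on the replies. -/
abbrev Strategy (n s : ℕ) : Type := History n s → Fin n → PMF (Reply n s)

/-- The law of the history after `t` rounds: in every round a vertex `u` is chosen uniformly at
random, independently of the past, and then the reply is drawn from the distribution prescribed
by the strategy. -/
def law {n s : ℕ} [NeZero n] (S : Strategy n s) : ℕ → PMF (History n s)
  | 0 => PMF.pure []
  | t + 1 => (law S t).bind fun h =>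
      (PMF.uniformOfFintype (Fin n)).bind fun u =>
        (S h u).map fun A => (u, A) :: h

/-- The probability that the hypergraph after `t` rounds has the property `P`. -/
def prob {n s : ℕ} [NeZero n] (S : Strategy n s) (P : MultiHypergraph n → Prop) (t : ℕ) :
    ENNReal :=
  (law S t).toOuterMeasure {h | P (graph h)}

/-- The least `t` for which the strategy `S` achieves `P` within `t` rounds with probability at
least `q`; it is `⊤` if there is no such `t`. -/
def strategyTime {n s : ℕ} [NeZero n] (S : Strategy n s) (P : MultiHypergraph n → Prop) (q : ℝ) :
    ℕ∞ :=
  ⨅ t ∈ {t : ℕ | ENNReal.ofReal q ≤ prob S P t}, (t : ℕ∞)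

/-- The infimum of `strategyTime` over all strategies on `[n]`. -/
def optimalTime (s : ℕ) {n : ℕ} [NeZero n] (P : MultiHypergraph n → Prop) (q : ℝ) : ℕ∞ :=
  ⨅ S : Strategy n s, strategyTime S P q

/-- The upper limit of `ln τ(q, n) / ln n` as `n → ∞`, where `τ(q, n)` is the optimal time on
`[n]`; it is written with `n + 1` in place of `n`, since the process needs at least one vertex.
It is an extended real number: `ln ∞ = ∞` and `ln 0 = -∞`. -/
def upperExponent (s : ℕ) (P : ∀ n : ℕ, MultiHypergraph n → Prop) (q : ℝ) : EReal :=
  limsup (fun n : ℕ =>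
    ENNReal.log ((optimalTime s (P (n + 1)) q : ℕ∞) : ENNReal) /
      ((Real.log ((n + 1 : ℕ) : ℝ) : ℝ) : EReal)) atTop

/-- `τ` is the threshold exponent of `P`: the limit, as `q` tends to `1` from below, of the upper
limit of `ln τ(q, n) / ln n`. -/
def IsThresholdExponent (s : ℕ) (P : ∀ n : ℕ, MultiHypergraph n → Prop) (τ : EReal) : Prop :=
  Tendsto (upperExponent s P) (𝓝[<] (1 : ℝ)) (𝓝 τ)

/-- The property of containing a copy of `G`: some injection of the vertices of `G` into `[n]`
maps every edge of `G` to an edge of `H`. -/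
def Contains {V : Type*} {s : ℕ} (G : UniformHypergraph V s) (n : ℕ) (H : MultiHypergraph n) :
    Prop :=
  ∃ φ : V ↪ Fin n, ∀ e ∈ G.edges, (e.map φ).val ∈ H

end SemiRandom

end

noncomputable section

namespace SemiRandom

variable {n s : ℕ}

/-! ### Expectations of functions of the history -/

/-! Lower bound. As `G` is not `(d - 1)`-degenerate, it has a piece in which all degrees are at
least `d`. Direct each round from its random vertex to the vertices of its reply. Remove the rounds
of a copy of this piece, latest first, and after each removal keep only the vertices from which the
removed random vertex can be reached. What is kept contains the random vertex of every remaining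
round that covers one of its vertices, so a removal lowers degrees by at most one, and `d` removals
are possible. A vertex `x` kept to the end has had the random vertex land in its ball `d` times
(`exists_le_hits_of_closed`). If out-degrees are at most `d`, balls have bounded size; a larger
out-degree yields `d` hits at once. A hit has conditional probability O(1/n), so the expected number
of `d`-sets of hits is O(n (t/n)^d) (`mean_sum_choose_hits_le`), which forces t to be of order at
least n^((d-1)/d).

Upper bound. Order the vertices of `G` so that each closes at most `d` edges with earlier ones, and
embed them in this order (`win_contains`). To place a vertex that needs ℓ ≤ d replies, take a pool
of y^ℓ vertices, with y about n^(1/d)/2; give the first reply until y^(ℓ-1) pool vertices have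
received it, continue inside those, and so on (`Win.join`). Each stage takes at most 2n/y rounds on
average, and there are boundedly many stages.

The constants do not depend on n, so the exponent is already (d-1)/d for every q in (0, 1). -/

/-- The expectation of a nonnegative function under a probability mass function. -/
def mean {α : Type*} (p : PMF α) (g : α → ENNReal) : ENNReal := ∑' a, p a * g a

theorem mean_mono {α : Type*} (p : PMF α) {f g : α → ENNReal} (h : ∀ a, f a ≤ g a) :
    mean p f ≤ mean p g :=
  ENNReal.tsum_le_tsum fun a => mul_le_mul_right (h a) _

theorem mean_const {α : Type*} (p : PMF α) (c : ENNReal) : mean p (fun _ => c) = c := by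
  simp [mean, ENNReal.tsum_mul_right, p.tsum_coe]

theorem mean_add {α : Type*} (p : PMF α) (f g : α → ENNReal) :
    mean p (fun a => f a + g a) = mean p f + mean p g := by
  simp [mean, mul_add, ENNReal.tsum_add]

theorem mean_const_mul {α : Type*} (p : PMF α) (c : ENNReal) (f : α → ENNReal) :
    mean p (fun a => c * f a) = c * mean p f := by
  simp only [mean, ← ENNReal.tsum_mul_left]
  exact tsum_congr fun a => mul_left_comm _ _ _

theorem mean_pure {α : Type*} (a : α) (g : α → ENNReal) : mean (PMF.pure a) g = g a := by
  rw [mean, tsum_eq_single a]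
  · simp
  · intro b hb
    simp [PMF.pure_apply, hb]

theorem mean_bind {α β : Type*} (p : PMF α) (k : α → PMF β) (g : β → ENNReal) :
    mean (p.bind k) g = mean p fun a => mean (k a) g := by
  simp only [mean, PMF.bind_apply, ← ENNReal.tsum_mul_right, ← ENNReal.tsum_mul_left]
  rw [ENNReal.tsum_comm]
  exact tsum_congr fun a => tsum_congr fun b => mul_assoc _ _ _

theorem mean_map {α β : Type*} (p : PMF α) (k : α → β) (g : β → ENNReal) :
    mean (p.map k) g = mean p fun a => g (k a) := by
  rw [← PMF.bind_pure_comp, mean_bind]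
  simp [mean_pure]

theorem mean_uniform [NeZero n] (g : Fin n → ENNReal) :
    mean (PMF.uniformOfFintype (Fin n)) g = (n : ENNReal)⁻¹ * ∑ u, g u := by
  simp [mean, tsum_fintype, Finset.mul_sum]

theorem mean_law_succ [NeZero n] (S : Strategy n s) (t : ℕ) (g : History n s → ENNReal) :
    mean (law S (t + 1)) g = mean (law S t) fun h =>
      (n : ENNReal)⁻¹ * ∑ u, mean (S h u) fun A => g ((u, A) :: h) := by
  simp only [law, mean_bind, mean_uniform, mean_map]

theorem prob_le_mean [NeZero n] (S : Strategy n s) (P : MultiHypergraph n → Prop) (t : ℕ)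
    (g : History n s → ENNReal) (hg : ∀ h, P (graph h) → 1 ≤ g h) :
    prob S P t ≤ mean (law S t) g := by
  rw [prob, PMF.toOuterMeasure_apply, mean]
  refine ENNReal.tsum_le_tsum fun h => ?_
  by_cases hP : P (graph h)
  · simpa [hP] using mul_le_mul_right (hg h hP) (law S t h)
  · simp [hP]

/-! ### Vertices reachable from a vertex -/

/-- The number of rounds in which `z` was the random vertex. -/
def outDegree (h : History n s) (z : Fin n) : ℕ := h.countP fun m => m.1 = z

/-- The vertices chosen by the player in the rounds in which `z` was the random vertex, provided
that there were at most `D` such rounds. -/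
def outNeighbors (D : ℕ) (h : History n s) (z : Fin n) : Finset (Fin n) :=
  if outDegree h z ≤ D then (h.filter fun m => m.1 = z).toFinset.biUnion fun m => m.2.1 else ∅

/-- The vertices that can be reached from `z` by at most `k` steps from a random vertex to a vertex
of the corresponding reply. -/
def outBall (D : ℕ) (h : History n s) : ℕ → Fin n → Finset (Fin n)
  | 0, z => {z}
  | k + 1, z => insert z ((outNeighbors D h z).biUnion (outBall D h k))

/-- The number of rounds in which the random vertex belongs to the ball of radius `K` about `x` in
the hypergraph built before. -/
def hits (D K : ℕ) (x : Fin n) : History n s → ℕ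
  | [] => 0
  | m :: h => hits D K x h + if m.1 ∈ outBall D h K x then 1 else 0

theorem card_outNeighbors_le (D : ℕ) (h : History n s) (z : Fin n) :
    (outNeighbors D h z).card ≤ D * s := by
  unfold outNeighbors
  split_ifs with hD
  · refine Finset.card_biUnion_le.trans ?_
    refine (Finset.sum_le_card_nsmul _ _ s fun m _ => ?_).trans ?_
    · have := m.2.2
      omega
    · rw [smul_eq_mul]
      refine Nat.mul_le_mul_right s ((List.toFinset_card_le _).trans ?_)
      rw [← List.countP_eq_length_filter]
      exact hD
  · simp

theorem card_outBall_le (D : ℕ) (h : History n s) (k : ℕ) (z : Fin n) :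
    (outBall D h k z).card ≤ (1 + D * s) ^ k := by
  induction k generalizing z with
  | zero => simp [outBall]
  | succ k ih =>
    have h1 : ((outNeighbors D h z).biUnion (outBall D h k)).card ≤ D * s * (1 + D * s) ^ k := by
      refine Finset.card_biUnion_le.trans ?_
      refine (Finset.sum_le_card_nsmul _ _ _ fun m _ => ih m).trans ?_
      exact Nat.mul_le_mul_right _ (card_outNeighbors_le D h z)
    have h2 := Finset.card_insert_le z ((outNeighbors D h z).biUnion (outBall D h k))
    have h3 : 1 ≤ (1 + D * s) ^ k := Nat.one_le_pow _ _ (by omega)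
    rw [outBall, pow_succ]
    nlinarith

theorem self_mem_outBall (D : ℕ) (h : History n s) (k : ℕ) (z : Fin n) : z ∈ outBall D h k z := by
  cases k <;> simp [outBall]

theorem outBall_succ (D : ℕ) (h : History n s) (k : ℕ) (z : Fin n) :
    outBall D h k z ⊆ outBall D h (k + 1) z := by
  induction k generalizing z with
  | zero => simp [outBall]
  | succ k ih =>
    rw [outBall, outBall]
    exact Finset.insert_subset_insert _ (Finset.biUnion_mono fun y _ => ih y)

theorem mem_outBall_succ {D : ℕ} {h : History n s} {k : ℕ} {z y u : Fin n} {A : Reply n s}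
    (hD : outDegree h z ≤ D) (hm : (z, A) ∈ h) (hy : y ∈ A.1) (hu : u ∈ outBall D h k y) :
    u ∈ outBall D h (k + 1) z := by
  refine Finset.mem_insert_of_mem (Finset.mem_biUnion.2 ⟨y, ?_, hu⟩)
  rw [outNeighbors, if_pos hD]
  exact Finset.mem_biUnion.2 ⟨(z, A), by simp [hm], hy⟩

theorem outDegree_le_cons (m : Fin n × Reply n s) (h : History n s) (z : Fin n) :
    outDegree h z ≤ outDegree (m :: h) z := by
  simp [outDegree, List.countP_cons]

/-- A vertex lies in its own ball even when its out-degree exceeds the cap `D`, so every round at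
`z` is a hit. This settles the case of large out-degree. -/
theorem outDegree_le_hits (D K : ℕ) (h : History n s) (z : Fin n) :
    outDegree h z ≤ hits D K z h := by
  induction h with
  | nil => simp [outDegree]
  | cons m h ih =>
    have h1 : outDegree (m :: h) z = outDegree h z + if m.1 = z then 1 else 0 := by
      simp [outDegree, List.countP_cons]
    rw [h1, hits]
    refine add_le_add ih ?_
    split_ifs with h2 h3 <;> simp_all [self_mem_outBall]

/-- The expected number of `k`-sets of hits is at most `n (M t / n) ^ k`, where `M` bounds the
size of the balls. -/
theorem mean_sum_choose_hits_le [NeZero n] (S : Strategy n s) (D K k t : ℕ) :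
    mean (law S t) (fun h => ∑ x, (((hits D K x h).choose k : ℕ) : ENNReal)) ≤
      n * ((((1 + D * s) ^ K : ℕ) : ENNReal) * (n : ENNReal)⁻¹ * t) ^ k := by
  set M : ENNReal := (((1 + D * s) ^ K : ℕ) : ENNReal) with hM
  have hn0 : (n : ENNReal) ≠ 0 := by exact_mod_cast NeZero.ne n
  have hnt : (n : ENNReal) ≠ ⊤ := ENNReal.natCast_ne_top n
  induction t generalizing k with
  | zero =>
    rw [law, mean_pure]
    cases k <;> simp [hits]
  | succ t ih =>
    cases k with
    | zero => simp [mean_const]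
    | succ k =>
      -- The ball about `x` is fixed before `u` is drawn, so it is hit with probability at most M/n;
      -- by Pascal's rule a hit adds `choose k` to `choose (k + 1)`.
      have step : ∀ h : History n s, (n : ENNReal)⁻¹ * ∑ u, mean (S h u) (fun A =>
          ∑ x, (((hits D K x ((u, A) :: h)).choose (k + 1) : ℕ) : ENNReal)) ≤
          ∑ x, (((hits D K x h).choose (k + 1) : ℕ) : ENNReal) +
            M * (n : ENNReal)⁻¹ * ∑ x, (((hits D K x h).choose k : ℕ) : ENNReal) := by
        intro h
        have e : ∀ u x, (((hits D K x h + if u ∈ outBall D h K x then 1 else 0).choose (k + 1) : ℕ)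
            : ENNReal) = (((hits D K x h).choose (k + 1) : ℕ) : ENNReal) +
              if u ∈ outBall D h K x then (((hits D K x h).choose k : ℕ) : ENNReal) else 0 := by
          intro u x
          split_ifs
          · rw [Nat.choose_succ_succ, Nat.cast_add, add_comm]
          · simp
        simp only [hits, mean_const, e, Finset.sum_add_distrib, mul_add]
        refine add_le_add (le_of_eq ?_) ?_
        · simp [← mul_assoc, ENNReal.inv_mul_cancel hn0 hnt]
        · rw [Finset.sum_comm, mul_comm M, mul_assoc, Finset.mul_sum (a := M)]
          refine mul_le_mul_right (Finset.sum_le_sum fun x _ => ?_) _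
          rw [← Finset.sum_filter, Finset.sum_const, nsmul_eq_mul]
          refine mul_le_mul_left ?_ _
          rw [hM]
          exact_mod_cast (by simpa using card_outBall_le D h K x)
      rw [mean_law_succ]
      refine (mean_mono _ step).trans ?_
      rw [mean_add, mean_const_mul]
      refine (add_le_add (ih (k + 1)) (mul_le_mul_right (ih k) _)).trans ?_
      have h1 : (t : ENNReal) ^ (k + 1) + (t : ENNReal) ^ k ≤ ((t + 1 : ℕ) : ENNReal) ^ (k + 1) := by
        have : t ^ (k + 1) + t ^ k ≤ (t + 1) ^ (k + 1) := by
          have := Nat.pow_le_pow_left (Nat.le_succ t) k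
          calc t ^ (k + 1) + t ^ k = t ^ k * (t + 1) := by ring
            _ ≤ (t + 1) ^ k * (t + 1) := Nat.mul_le_mul_right _ this
            _ = _ := by ring
        exact_mod_cast this
      calc _ = n * (M * (n : ENNReal)⁻¹) ^ (k + 1) * ((t : ENNReal) ^ (k + 1) + (t : ENNReal) ^ k) := by
            rw [mul_pow, mul_pow _ (t : ENNReal)]; ring
        _ ≤ n * (M * (n : ENNReal)⁻¹) ^ (k + 1) * ((t + 1 : ℕ) : ENNReal) ^ (k + 1) :=
            mul_le_mul_right h1 _
        _ = _ := by rw [mul_pow _ ((t + 1 : ℕ) : ENNReal)]; ring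

/-! ### Dense pieces force many hits -/

/-- The vertices of `Z` from which `u` can be reached in at most `k` steps along `E`. -/
def backBall (E : Finset (Fin n × Reply n s)) (Z : Finset (Fin n)) (u : Fin n) :
    ℕ → Finset (Fin n)
  | 0 => {u}
  | k + 1 => backBall E Z u k ∪
      Z.filter fun z => ∃ m ∈ E, m.1 = z ∧ ∃ y ∈ m.2.1, y ∈ backBall E Z u k

theorem backBall_subset {E : Finset (Fin n × Reply n s)} {Z : Finset (Fin n)} {u : Fin n}
    (hu : u ∈ Z) (k : ℕ) : backBall E Z u k ⊆ Z := by
  induction k with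
  | zero => simpa [backBall] using hu
  | succ k ih => exact Finset.union_subset ih (Finset.filter_subset _ _)

/-- The balls grow inside `Z`, so they are constant after |Z| steps. A stable back-ball contains
every vertex of `Z` with a step into it, which is the closure property needed to repeat the
argument. -/
theorem backBall_stable {E : Finset (Fin n × Reply n s)} {Z : Finset (Fin n)} {u : Fin n}
    (hu : u ∈ Z) {K : ℕ} (hK : Z.card ≤ K) : backBall E Z u (K + 1) = backBall E Z u K := by
  have hsub : ∀ k, backBall E Z u k ⊆ backBall E Z u (k + 1) := fun k => Finset.subset_union_left
  have hmono : Monotone fun k => (backBall E Z u k).card :=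
    monotone_nat_of_le_succ fun k => Finset.card_le_card (hsub k)
  have hst := fun k (hk : Z.card ≤ k) => Nat.stabilises_of_monotone hmono
    (fun m => Finset.card_le_card (backBall_subset hu m))
    (fun m hm => by
      have h1 := Finset.eq_of_subset_of_card_le (hsub m) hm.ge
      have h2 : backBall E Z u (m + 2) = backBall E Z u (m + 1) := by
        conv_rhs => rw [backBall]
        rw [backBall, ← h1]
      exact congrArg Finset.card h2.symm) hk
  exact (Finset.eq_of_subset_of_card_le (hsub K)
    ((hst (K + 1) (by omega)).trans (hst K hK).symm).le).symm

theorem mem_outBall_of_mem_backBall {D : ℕ} {h : History n s} {E : Finset (Fin n × Reply n s)}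
    {Z : Finset (Fin n)} {u : Fin n} (hD : ∀ z, outDegree h z ≤ D) (hE : ∀ m ∈ E, m ∈ h) {k : ℕ}
    {z : Fin n} (hz : z ∈ backBall E Z u k) : u ∈ outBall D h k z := by
  induction k generalizing z with
  | zero => simpa [backBall, outBall, eq_comm] using hz
  | succ k ih =>
    rw [backBall, Finset.mem_union, Finset.mem_filter] at hz
    obtain hz | ⟨-, ⟨w, A⟩, hm, rfl, y, hy, hyk⟩ := hz
    · exact outBall_succ D h k z (ih hz)
    · exact mem_outBall_succ (hD _) (hE _ hm) hy (ih hyk)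

/-- If a nonempty set `Z` contains the random vertex of every round of `E` whose reply meets `Z`,
and every vertex of `Z` is covered by at least `d` rounds of `E`, then some vertex of `Z` has at
least `d` hits. -/
theorem exists_le_hits_of_closed {D K : ℕ} (h : History n s) (hD : ∀ z, outDegree h z ≤ D) (d : ℕ)
    (E : Finset (Fin n × Reply n s)) (hE : ∀ m ∈ E, m ∈ h) (Z : Finset (Fin n)) (hZ : Z.Nonempty)
    (hK : Z.card ≤ K) (hcl : ∀ m ∈ E, (∃ z ∈ m.2.1, z ∈ Z) → m.1 ∈ Z)
    (hdeg : ∀ z ∈ Z, d ≤ (E.filter fun m => m.1 = z ∨ z ∈ m.2.1).card) :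
    ∃ x ∈ Z, d ≤ hits D K x h := by
  induction h generalizing d E Z with
  | nil =>
    obtain ⟨z, hz⟩ := hZ
    have : E = ∅ := Finset.eq_empty_of_forall_notMem fun m hm => by simpa using hE m hm
    refine ⟨z, hz, ?_⟩
    simpa [this, hits] using hdeg z hz
  | cons m h ih =>
    have hD' : ∀ z, outDegree h z ≤ D := fun z => (outDegree_le_cons m h z).trans (hD z)
    -- Discarding the rounds with random vertex outside `Z` loses no degree in `Z`: by `hcl` they
    -- cover no vertex of `Z`.
    set E' := (E.filter fun m => m.1 ∈ Z).erase m with hE'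
    have hsub : ∀ m' ∈ E', m' ∈ h := by
      intro m' hm'
      rw [hE', Finset.mem_erase, Finset.mem_filter] at hm'
      exact (List.mem_cons.1 (hE m' hm'.2.1)).resolve_left hm'.1
    have hEE : ∀ m' ∈ E', m' ∈ E ∧ m'.1 ∈ Z := fun m' hm' =>
      Finset.mem_filter.1 (Finset.mem_of_mem_erase hm')
    by_cases hm : m ∈ E ∧ m.1 ∈ Z
    · cases d with
      | zero => exact ⟨hZ.choose, hZ.choose_spec, Nat.zero_le _⟩
      | succ d =>
        have hB := backBall_subset (E := E') hm.2 K
        have hdeg' : ∀ z ∈ Z, d ≤ (E'.filter fun m => m.1 = z ∨ z ∈ m.2.1).card := by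
          intro z hz
          have h1 : (E.filter fun m => m.1 = z ∨ z ∈ m.2.1) ⊆
              insert m (E'.filter fun m => m.1 = z ∨ z ∈ m.2.1) := by
            intro m' hm'
            rw [Finset.mem_filter] at hm'
            rw [Finset.mem_insert, Finset.mem_filter, hE', Finset.mem_erase, Finset.mem_filter]
            by_cases hmm : m' = m
            · exact Or.inl hmm
            · refine Or.inr ⟨⟨hmm, hm'.1, ?_⟩, hm'.2⟩
              rcases hm'.2 with rfl | h2
              · exact hz
              · exact hcl m' hm'.1 ⟨z, h2, hz⟩
          have h2 := (hdeg z hz).trans ((Finset.card_le_card h1).trans (Finset.card_insert_le _ _))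
          omega
        -- Every vertex of this back-ball reaches `m.1` along earlier rounds, so whichever `x` the
        -- induction returns, the round `m` is one more hit for it.
        obtain ⟨x, hx, hxd⟩ := ih hD' d E' hsub (backBall E' Z m.1 K)
          ⟨m.1, by
            have : ∀ k, m.1 ∈ backBall E' Z m.1 k := by
              intro k
              induction k with
              | zero => simp [backBall]
              | succ k ih => exact Finset.mem_union_left _ ih
            exact this K⟩
          ((Finset.card_le_card hB).trans hK)
          (by
            rintro m' hm' ⟨z, hz, hzB⟩
            rw [← backBall_stable hm.2 hK, backBall, Finset.mem_union, Finset.mem_filter]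
            exact Or.inr ⟨(hEE m' hm').2, m', hm', rfl, z, hz, hzB⟩)
          (fun z hz => hdeg' z (hB hz))
        refine ⟨x, hB hx, ?_⟩
        rw [hits, if_pos (mem_outBall_of_mem_backBall hD' hsub hx)]
        omega
    · have hEq : E' = E.filter fun m => m.1 ∈ Z := by
        rw [hE', Finset.erase_eq_of_notMem]
        simpa using hm
      obtain ⟨x, hx, hxd⟩ := ih hD' d E' hsub Z hZ hK (fun m' hm' _ => (hEE m' hm').2) (by
        intro z hz
        refine (hdeg z hz).trans (Finset.card_le_card ?_)
        intro m' hm'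
        rw [Finset.mem_filter] at hm' ⊢
        rw [hEq, Finset.mem_filter]
        refine ⟨⟨hm'.1, ?_⟩, hm'.2⟩
        rcases hm'.2 with rfl | h2
        · exact hz
        · exact hcl m' hm'.1 ⟨z, h2, hz⟩)
      refine ⟨x, hx, hxd.trans ?_⟩
      rw [hits]
      omega

theorem exists_le_hits_of_contains {V : Type*} [DecidableEq V] {G : UniformHypergraph V s}
    {d K : ℕ} {W : Finset V} {F : Finset (Finset V)} (hW : W.Nonempty) (hFG : F ⊆ G.edges)
    (hFW : ∀ e ∈ F, e ⊆ W) (hdeg : ∀ v ∈ W, d ≤ (F.filter fun e => v ∈ e).card)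
    (hK : W.card ≤ K) (h : History n s) (hG : Contains G n (graph h)) :
    ∃ x, d ≤ hits d K x h := by
  -- Above the cap `outNeighbors` is empty and reachability breaks down, but then the out-degree
  -- alone supplies the hits.
  by_cases hD : ∀ z, outDegree h z ≤ d
  swap
  · push Not at hD
    obtain ⟨z, hz⟩ := hD
    exact ⟨z, hz.le.trans (outDegree_le_hits d K h z)⟩
  obtain ⟨φ, hφ⟩ := hG
  have hex : ∀ e : F, ∃ m ∈ h, edge m = (e.1.map φ).val := by
    intro e
    have := hφ e.1 (hFG e.2)
    simpa [graph] using this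
  choose r hrh hr using hex
  have hmem : ∀ (e : F) (z : Fin n), ((r e).1 = z ∨ z ∈ (r e).2.1) ↔ z ∈ e.1.map φ := by
    intro e z
    rw [← Finset.mem_val (s := e.1.map φ), ← hr e, edge, Multiset.mem_cons, Finset.mem_val, eq_comm]
  have hinj : Function.Injective r := by
    intro e e' hee
    have : (e.1.map φ).val = (e'.1.map φ).val := by rw [← hr, ← hr, hee]
    exact Subtype.ext (Finset.map_injective φ (Finset.val_injective this))
  obtain ⟨x, -, hx⟩ := exists_le_hits_of_closed (K := K) h hD d (Finset.univ.image r) (by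
      intro m hm
      obtain ⟨e, -, rfl⟩ := Finset.mem_image.1 hm
      exact hrh e) (W.map φ) (by simpa using hW) (by simpa using hK) (by
      intro m hm _
      obtain ⟨e, -, rfl⟩ := Finset.mem_image.1 hm
      exact Finset.map_subset_map.2 (hFW e.1 e.2) ((hmem e _).1 (Or.inl rfl))) (by
      intro z hz
      obtain ⟨v, hv, rfl⟩ := Finset.mem_map.1 hz
      refine (hdeg v hv).trans ?_
      rw [← Finset.card_attach]
      refine Finset.card_le_card_of_injOn
        (fun e => r ⟨e.1, (Finset.mem_filter.1 e.2).1⟩) ?_ ?_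
      · intro e _
        refine Finset.mem_coe.2 (Finset.mem_filter.2 ⟨by simp, (hmem _ _).2 ?_⟩)
        exact Finset.mem_map_of_mem φ (Finset.mem_filter.1 e.2).2
      · intro e _ e' _ hee
        exact Subtype.ext (congrArg (fun a : F => a.1) (hinj hee)))
  exact ⟨x, hx⟩

theorem prob_contains_le {V : Type*} [DecidableEq V] [NeZero n] {G : UniformHypergraph V s}
    {d : ℕ} {W : Finset V} {F : Finset (Finset V)} (hW : W.Nonempty) (hFG : F ⊆ G.edges)
    (hFW : ∀ e ∈ F, e ⊆ W) (hdeg : ∀ v ∈ W, d ≤ (F.filter fun e => v ∈ e).card)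
    (S : Strategy n s) (t : ℕ) :
    prob S (Contains G n) t ≤
      n * ((((1 + d * s) ^ W.card : ℕ) : ENNReal) * (n : ENNReal)⁻¹ * t) ^ d := by
  refine (prob_le_mean S _ t _ fun h hG => ?_).trans (mean_sum_choose_hits_le S d W.card d t)
  obtain ⟨x, hx⟩ := exists_le_hits_of_contains hW hFG hFW hdeg le_rfl h hG
  refine le_trans ?_ (Finset.single_le_sum (f := fun x => (((hits d W.card x h).choose d : ℕ) :
    ENNReal)) (fun _ _ => zero_le) (Finset.mem_univ x))
  exact_mod_cast Nat.choose_pos hx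

/-! ### Optimal play -/

open scoped Classical in
/-- The least probability of missing `P` within `t` further rounds that the player can achieve,
starting from the hypergraph `H`. -/
def failure (s : ℕ) (P : MultiHypergraph n → Prop) : ℕ → MultiHypergraph n → ℝ
  | 0, H => if P H then 0 else 1
  | t + 1, H => if P H then 0 else
      (∑ u : Fin n, ⨅ A : Reply n s, failure s P t (edge (u, A) ::ₘ H)) / n

theorem failure_nonneg (P : MultiHypergraph n → Prop) (t : ℕ) (H : MultiHypergraph n) :
    0 ≤ failure s P t H := by
  induction t generalizing H with
  | zero => rw [failure]; split_ifs <;> norm_num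
  | succ t ih =>
    rw [failure]
    split_ifs
    · exact le_rfl
    · exact div_nonneg (Finset.sum_nonneg fun u _ => Real.iInf_nonneg fun A => ih _)
        (Nat.cast_nonneg n)

theorem iInf_failure_le (P : MultiHypergraph n → Prop) (t : ℕ) (H : MultiHypergraph n) (u : Fin n)
    (A : Reply n s) :
    ⨅ A : Reply n s, failure s P t (edge (u, A) ::ₘ H) ≤ failure s P t (edge (u, A) ::ₘ H) :=
  ciInf_le (Set.finite_range _).bddBelow A

theorem failure_le_one [Nonempty (Reply n s)] [NeZero n] (P : MultiHypergraph n → Prop) (t : ℕ)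
    (H : MultiHypergraph n) : failure s P t H ≤ 1 := by
  induction t generalizing H with
  | zero => rw [failure]; split_ifs <;> norm_num
  | succ t ih =>
    rw [failure]
    split_ifs
    · exact zero_le_one
    · have hn : (0 : ℝ) < n := by exact_mod_cast NeZero.pos n
      rw [div_le_one hn]
      refine (Finset.sum_le_card_nsmul _ _ 1 fun u _ => ?_).trans (by simp)
      exact (iInf_failure_le P t H u (Classical.arbitrary _)).trans (ih _)

/-- Optimal play reaches a monotone property with probability at least `1 - failure`. -/
theorem exists_strategy_one_sub_failure_le [Nonempty (Reply n s)] [NeZero n]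
    {P : MultiHypergraph n → Prop} (hP : ∀ H e, P H → P (e ::ₘ H)) (T : ℕ) :
    ∃ S : Strategy n s, ENNReal.ofReal (1 - failure s P T 0) ≤ prob S P T := by
  classical
  have hmin : ∀ (h : History n s) (u : Fin n), ∃ A : Reply n s,
      failure s P (T - h.length - 1) (edge (u, A) ::ₘ graph h) =
        ⨅ A : Reply n s, failure s P (T - h.length - 1) (edge (u, A) ::ₘ graph h) := fun h u =>
    exists_eq_ciInf_of_finite
  choose A hA using hmin
  let S : Strategy n s := fun h u => PMF.pure (A h u)
  have hgraph : ∀ (m : Fin n × Reply n s) h, graph (m :: h) = edge m ::ₘ graph h := fun m h => rfl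
  -- The optimal failure probability does not increase on average. The strategy reads the remaining
  -- time off the length of the history; the value `⊤` on other lengths builds into the bound that
  -- they have probability zero.
  have key : ∀ t ≤ T, mean (law S t) (fun h => if h.length = t then
      ENNReal.ofReal (failure s P (T - t) (graph h)) else ⊤) ≤
        ENNReal.ofReal (failure s P T 0) := by
    intro t
    induction t with
    | zero => intro _; simp [law, mean_pure, graph]
    | succ t ih =>
      intro ht
      rw [mean_law_succ]
      refine (mean_mono _ fun h => ?_).trans (ih (by omega))
      split_ifs with hl
      · have e : T - t = (T - (t + 1)) + 1 := by omega
        simp only [S, mean_pure, List.length_cons, hl, if_true, hgraph]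
        by_cases hPh : P (graph h)
        · have h0 : ∀ k H, P H → failure s P k H = 0 := by
            intro k H hH
            cases k <;> simp [failure, hH]
          simp [h0 _ _ (hP _ _ hPh)]
        · rw [e, failure, if_neg hPh, div_eq_inv_mul, ENNReal.ofReal_mul (by positivity),
            ENNReal.ofReal_inv_of_pos (by exact_mod_cast NeZero.pos n), ENNReal.ofReal_natCast,
            ENNReal.ofReal_sum_of_nonneg fun u _ => Real.iInf_nonneg fun A => failure_nonneg P _ _]
          refine mul_le_mul_right (Finset.sum_le_sum fun u _ => ?_) _
          have := hA h u
          rw [hl, Nat.sub_sub] at this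
          rw [this]
      · exact le_top
  refine ⟨S, ?_⟩
  have hfail := key T le_rfl
  have h1 : (1 : ENNReal) ≤ prob S P T + ENNReal.ofReal (failure s P T 0) := by
    refine le_trans ?_ (add_le_add le_rfl hfail)
    rw [prob, PMF.toOuterMeasure_apply, mean, ← ENNReal.tsum_add, ← (law S T).tsum_coe]
    refine ENNReal.tsum_le_tsum fun h => ?_
    by_cases hPh : P (graph h)
    · simp [hPh]
    · simp only [Set.indicator, Set.mem_ofPred_eq, hPh, if_false, zero_add, Nat.sub_self]
      split_ifs
      · simp [failure, hPh]
      · exact le_mul_of_one_le_right zero_le le_top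
  rw [ENNReal.ofReal_sub _ (failure_nonneg P T 0), ENNReal.ofReal_one]
  exact tsub_le_iff_right.2 h1

/-! ### Time budgets for building a hypergraph in stages -/

/-- `Win s P v H`: from every hypergraph containing `H`, optimal play misses `P` within `t` rounds
with probability at most `v / (t + 1)`. -/
def Win (s : ℕ) (P : MultiHypergraph n → Prop) (v : ℝ) (H : MultiHypergraph n) : Prop :=
  ∀ H', H ≤ H' → ∀ t, failure s P t H' * (t + 1) ≤ v

theorem Win.mono {P : MultiHypergraph n → Prop} {v v' : ℝ} {H H' : MultiHypergraph n}
    (h : Win s P v H) (hv : v ≤ v') (hH : H ≤ H') : Win s P v' H' :=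
  fun H'' h'' t => (h H'' (hH.trans h'') t).trans hv

theorem Win.of_property {P : MultiHypergraph n → Prop} {H : MultiHypergraph n}
    (h : ∀ H', H ≤ H' → P H') : Win s P 0 H := by
  intro H' hH t
  cases t <;> simp [failure, h H' hH]

/-- Waiting for a random vertex in `Q` costs `n / |Q|`. -/
theorem Win.wait [Nonempty (Reply n s)] [NeZero n] {P : MultiHypergraph n → Prop} {v : ℝ}
    {H : MultiHypergraph n} (hv : 0 ≤ v) (Q : Finset (Fin n)) (hQ : Q.Nonempty)
    (h : ∀ H', H ≤ H' → ∀ u ∈ Q, ∃ A : Reply n s, Win s P v (edge (u, A) ::ₘ H')) :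
    Win s P (v + n / Q.card) H := by
  have hn : (0 : ℝ) < n := by exact_mod_cast NeZero.pos n
  have hq : (0 : ℝ) < Q.card := by exact_mod_cast hQ.card_pos
  have hqn : (Q.card : ℝ) ≤ n := by exact_mod_cast (Finset.card_le_univ Q).trans (by simp)
  have h1 : 1 ≤ (n : ℝ) / Q.card := (one_le_div hq).2 hqn
  set w := v + n / Q.card with hw
  intro H' hH t
  induction t generalizing H' with
  | zero =>
    have := failure_le_one (s := s) P 0 H'
    norm_num
    linarith
  | succ t ih =>
    have ht : (0 : ℝ) < t + 1 := by positivity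
    -- For t + 2 ≤ w the trivial bound 1 suffices. Otherwise averaging over `u` gives (w - 1)/(t +
    -- 1), since |Q| (w - v) = n, and this is at most w/(t + 2) exactly when w ≤ t + 2.
    by_cases hbig : (t : ℝ) + 2 ≤ w
    · have := failure_le_one (s := s) P (t + 1) H'
      push_cast
      nlinarith
    push Not at hbig
    by_cases hP : P H'
    · rw [failure, if_pos hP, zero_mul]
      linarith
    have hsum : ∑ u : Fin n, ⨅ A : Reply n s, failure s P t (edge (u, A) ::ₘ H') ≤
        ∑ u : Fin n, (w / (t + 1) - if u ∈ Q then (w - v) / (t + 1) else 0) := by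
      refine Finset.sum_le_sum fun u _ => ?_
      split_ifs with hu
      · obtain ⟨A, hA⟩ := h H' hH u hu
        refine (iInf_failure_le P t H' u A).trans ?_
        have := hA _ le_rfl t
        rw [← sub_div, le_div_iff₀ ht]
        linarith
      · refine (iInf_failure_le P t H' u (Classical.arbitrary _)).trans ?_
        rw [sub_zero, le_div_iff₀ ht]
        exact ih _ (hH.trans (Multiset.le_cons_self _ _))
    have hval : ∑ u : Fin n, (w / (t + 1) - if u ∈ Q then (w - v) / ((t : ℝ) + 1) else 0) =
        n * (w - 1) / (t + 1) := by
      rw [Finset.sum_sub_distrib, ← Finset.sum_filter]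
      simp only [Finset.sum_const, Finset.filter_mem_eq_inter, Finset.univ_inter, nsmul_eq_mul,
        Finset.card_univ, Fintype.card_fin]
      have : w - v = n / Q.card := by rw [hw]; ring
      rw [this]
      field_simp
    have hf : failure s P (t + 1) H' ≤ (w - 1) / (t + 1) := by
      rw [failure, if_neg hP, div_le_iff₀ hn]
      refine (hsum.trans hval.le).trans (le_of_eq ?_)
      ring
    push_cast
    have h2 : (w - 1) / (t + 1) * ((t : ℝ) + 1 + 1) ≤ w := by
      rw [div_mul_eq_mul_div, div_le_iff₀ ht]
      nlinarith
    exact (mul_le_mul_of_nonneg_right hf (by positivity)).trans h2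

/-- Collecting `m` vertices of a pool, each joined to the same reply. -/
theorem Win.collect [Nonempty (Reply n s)] [NeZero n] {P : MultiHypergraph n → Prop} {v : ℝ}
    {H : MultiHypergraph n} (hv : 0 ≤ v) (pool : Finset (Fin n)) (R : Reply n s) {m : ℕ}
    (hm : m < pool.card)
    (h : ∀ H', H ≤ H' → ∀ B ⊆ pool, B.card = m → (∀ x ∈ B, edge (x, R) ∈ H') → Win s P v H') :
    Win s P (v + m * (n / ((pool.card : ℝ) - m))) H := by
  have hc : (0 : ℝ) < (pool.card : ℝ) - m := sub_pos.2 (by exact_mod_cast hm)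
  -- Here `k` counts the vertices still to be collected; throughout, at least `pool.card - m` pool
  -- vertices remain unused.
  have key : ∀ k ≤ m, ∀ H', H ≤ H' → ∀ B ⊆ pool, B.card + k = m → (∀ x ∈ B, edge (x, R) ∈ H') →
      Win s P (v + k * (n / ((pool.card : ℝ) - m))) H' := by
    intro k
    induction k with
    | zero =>
      intro _ H' hH B hB hBm hBe
      simpa using h H' hH B hB hBm hBe
    | succ k ih =>
      intro hk H' hH B hB hBm hBe
      have hcard : (pool \ B).card = pool.card - B.card := Finset.card_sdiff_of_subset hB
      have hpos : 0 < (pool \ B).card := by omega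
      have hw : Win s P (v + k * (n / ((pool.card : ℝ) - m)) + n / (pool \ B).card) H' := by
        refine Win.wait (by positivity) _ (Finset.card_pos.1 hpos) fun H'' hH'' u hu => ⟨R, ?_⟩
        rw [Finset.mem_sdiff] at hu
        refine ih (by omega) _ ((hH.trans hH'').trans (Multiset.le_cons_self _ _)) (insert u B)
          (Finset.insert_subset hu.1 hB) ?_ ?_
        · rw [Finset.card_insert_of_notMem hu.2]
          omega
        · intro x hx
          rcases Finset.mem_insert.1 hx with rfl | hx
          · exact Multiset.mem_cons_self _ _
          · exact Multiset.mem_cons_of_mem (Multiset.mem_of_le hH'' (hBe x hx))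
      refine hw.mono ?_ le_rfl
      have h2 : (pool.card : ℝ) - m ≤ (pool \ B).card := by
        rw [sub_le_iff_le_add]
        exact_mod_cast (by omega : pool.card ≤ (pool \ B).card + m)
      have h3 : (n : ℝ) / (pool \ B).card ≤ n / ((pool.card : ℝ) - m) :=
        div_le_div_of_nonneg_left (Nat.cast_nonneg n) hc h2
      push_cast
      linarith
  exact key m le_rfl H le_rfl ∅ (Finset.empty_subset _) (by simp) (by simp)

/-- Finding a vertex of a pool that is joined to all replies of a list. -/
theorem Win.join [Nonempty (Reply n s)] [NeZero n] {P : MultiHypergraph n → Prop} {v : ℝ}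
    (hv : 0 ≤ v) {y : ℕ} (hy : 2 ≤ y) (L : List (Reply n s)) {H : MultiHypergraph n}
    (pool : Finset (Fin n)) (hpool : y ^ L.length ≤ pool.card)
    (h : ∀ H', H ≤ H' → ∀ x ∈ pool, (∀ R ∈ L, edge (x, R) ∈ H') → Win s P v H') :
    Win s P (v + L.length * (2 * n / y)) H := by
  induction L generalizing H pool with
  | nil =>
    obtain ⟨x, hx⟩ := Finset.card_pos.1 (show 0 < pool.card by simpa using hpool)
    simpa using h H le_rfl x hx (by simp)
  | cons R L ih =>
    have hy0 : (0 : ℝ) < y := by exact_mod_cast (by omega : 0 < y)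
    have hpow : 0 < y ^ L.length := pow_pos (by omega) _
    have hlt : 2 * y ^ L.length ≤ pool.card := by
      rw [List.length_cons, pow_succ] at hpool
      nlinarith
    -- The pool shrinks by a factor of about `y` per reply. As `y ≥ 2`, at least half of it stays
    -- available, so collecting y^ℓ vertices out of at least y^(ℓ+1) costs at most 2n/y.
    have hw := Win.collect (H := H) (P := P) (v := v + L.length * (2 * n / y)) (by positivity) pool R
      (m := y ^ L.length) (by omega) (by
        intro H' hH B hB hBm hBe
        refine ih B hBm.ge fun H'' hH'' x hx hxL => h H'' (hH.trans hH'') x (hB hx) ?_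
        intro R' hR'
        rcases List.mem_cons.1 hR' with rfl | hR'
        · exact Multiset.mem_of_le hH'' (hBe x hx)
        · exact hxL R' hR')
    refine hw.mono ?_ le_rfl
    have h1 : (y : ℝ) ^ L.length * y ≤ pool.card := by
      rw [List.length_cons, pow_succ] at hpool
      exact_mod_cast hpool
    have h2 : (2 : ℝ) * y ^ L.length ≤ pool.card := by exact_mod_cast hlt
    have h3 : (0 : ℝ) < y ^ L.length := by positivity
    have h4 : (y : ℝ) ^ L.length * (n / ((pool.card : ℝ) - (y : ℝ) ^ L.length)) ≤ 2 * n / y := by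
      rw [mul_div_assoc', div_le_div_iff₀ (by linarith) hy0]
      have h5 : (y : ℝ) ^ L.length * y ≤ 2 * ((pool.card : ℝ) - (y : ℝ) ^ L.length) := by linarith
      have := mul_le_mul_of_nonneg_left h5 (Nat.cast_nonneg (α := ℝ) n)
      nlinarith
    rw [List.length_cons]
    push_cast
    linarith

theorem contains_mono {V : Type*} {G : UniformHypergraph V s} {H H' : MultiHypergraph n}
    (hH : H ≤ H') (h : Contains G n H) : Contains G n H' := by
  obtain ⟨φ, hφ⟩ := h
  exact ⟨φ, fun e he => Multiset.mem_of_le hH (hφ e he)⟩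

/-- A hypergraph of degeneracy at most `d` can be built vertex by vertex. -/
theorem win_contains {V : Type*} [Fintype V] [DecidableEq V] {G : UniformHypergraph V s} {d : ℕ}
    (hG : G.IsDegenerate d) [Nonempty (Reply n s)] [NeZero n] {y : ℕ} (hy : 2 ≤ y)
    (hyn : y ^ d + Fintype.card V ≤ n) :
    Win s (Contains G n) (Fintype.card V * (d * (2 * n / y))) 0 := by
  set c : ℝ := d * (2 * n / y) with hc
  have hc0 : 0 ≤ c := by positivity
  -- The induction peels off the vertex embedded last: a budget that suffices once `W` is embedded
  -- becomes, with `c` added, one that suffices once `W.erase x` is embedded.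
  have key : ∀ (k : ℕ) (W : Finset V), W.card = k → ∀ v : ℝ, 0 ≤ v →
      (∀ (H : MultiHypergraph n) (φ : V → Fin n), Set.InjOn φ W →
        (∀ e ∈ G.edges, e ⊆ W → e.val.map φ ∈ H) → Win s (Contains G n) v H) →
      Win s (Contains G n) (v + k * c) 0 := by
    intro k
    induction k with
    | zero =>
      intro W hW v _ h
      have hW0 := Finset.card_eq_zero.1 hW
      have hs : s ≠ 0 := by
        have := (Classical.arbitrary (Reply n s)).2
        omega
      simpa using h 0 (fun _ => 0) (by simp [hW0]) fun e he heW => by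
        have h1 := G.card_edge e he
        rw [hW0, Finset.subset_empty] at heW
        rw [heW, Finset.card_empty] at h1
        exact absurd h1.symm hs
    | succ k ih =>
      intro W hW v hv h
      obtain ⟨x, hx, hxd⟩ := hG W (G.edges.filter fun e => e ⊆ W)
        (Finset.card_pos.1 (by omega)) (Finset.filter_subset _ _)
        (fun e he => (Finset.mem_filter.1 he).2)
      have := ih (W.erase x) (by rw [Finset.card_erase_of_mem hx]; omega) (v + c) (by positivity) ?_
      · refine this.mono (le_of_eq ?_) le_rfl
        push_cast
        ring
      intro H φ hφ hφe
      set F := (G.edges.filter fun e => e ⊆ W).filter fun e => x ∈ e with hF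
      have hFm : ∀ e ∈ F, e ∈ G.edges ∧ e ⊆ W ∧ x ∈ e := by
        intro e he
        simpa [hF, and_assoc] using he
      have hrep : ∀ e ∈ F, ((e.erase x).image φ).card + 1 = s := by
        intro e he
        obtain ⟨h1, h2, h3⟩ := hFm e he
        rw [Finset.card_image_of_injOn (hφ.mono (by exact_mod_cast Finset.erase_subset_erase x h2)),
          Finset.card_erase_add_one h3, G.card_edge e h1]
      let L : List (Reply n s) := F.attach.toList.map fun e => ⟨(e.1.erase x).image φ, hrep e.1 e.2⟩
      have hL : L.length = F.card := by simp [L]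
      have hLd : L.length ≤ d := hL.trans_le hxd
      -- Leaving out the images already used keeps the extended map injective on `W`.
      set pool := Finset.univ \ (W.erase x).image φ with hpool
      have hpc : y ^ L.length ≤ pool.card := by
        have h1 : y ^ L.length ≤ y ^ d := Nat.pow_le_pow_right (by omega) hLd
        have h2 : pool.card = n - ((W.erase x).image φ).card := by
          rw [hpool, Finset.card_sdiff_of_subset (Finset.subset_univ _), Finset.card_univ,
            Fintype.card_fin]
        have h3 : ((W.erase x).image φ).card ≤ Fintype.card V :=
          Finset.card_image_le.trans (Finset.card_le_univ _)
        omega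
      refine (Win.join hv hy L pool hpc ?_ : Win s (Contains G n) _ H).mono ?_ le_rfl
      · intro H' hH z hz hzL
        have hzW : ∀ a ∈ W, a ≠ x → φ a ≠ z := by
          intro a ha hax haz
          rw [hpool, Finset.mem_sdiff] at hz
          exact hz.2 (Finset.mem_image.2 ⟨a, Finset.mem_erase.2 ⟨hax, ha⟩, haz⟩)
        refine h H' (Function.update φ x z) ?_ ?_
        · intro a ha b hb hab
          by_cases hax : a = x <;> by_cases hbx : b = x
          · rw [hax, hbx]
          · subst hax
            simp only [Function.update_self, Function.update_of_ne hbx] at hab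
            exact absurd hab.symm (hzW b hb hbx)
          · subst hbx
            simp only [Function.update_self, Function.update_of_ne hax] at hab
            exact absurd hab (hzW a ha hax)
          · rw [Function.update_of_ne hax, Function.update_of_ne hbx] at hab
            exact hφ (by simpa [hax] using ha) (by simpa [hbx] using hb) hab
        · intro e he heW
          by_cases hxe : x ∈ e
          · have heF : e ∈ F := by simp [hF, he, heW, hxe]
            have hR := hzL ⟨(e.erase x).image φ, hrep e heF⟩
              (List.mem_map.2 ⟨⟨e, heF⟩, by simp, rfl⟩)
            convert hR using 1
            conv_lhs => rw [← Finset.insert_erase hxe]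
            rw [Finset.insert_val_of_notMem (Finset.notMem_erase x e), Multiset.map_cons,
              Function.update_self, edge,
              Finset.image_val_of_injOn (hφ.mono (by
                exact_mod_cast Finset.erase_subset_erase x heW))]
            congr 1
            refine Multiset.map_congr rfl fun a ha => Function.update_of_ne ?_ _ _
            rintro rfl
            exact Finset.notMem_erase a e ha
          · have h1 : e.val.map (Function.update φ x z) = e.val.map φ :=
              Multiset.map_congr rfl fun a ha => Function.update_of_ne (by
                rintro rfl
                exact hxe ha) _ _
            rw [h1]
            exact Multiset.mem_of_le hH (hφe e he (Finset.subset_erase.2 ⟨heW, hxe⟩))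
      · have : (L.length : ℝ) * (2 * n / y) ≤ c :=
          mul_le_mul_of_nonneg_right (by exact_mod_cast hLd) (by positivity)
        linarith
  have := key (Fintype.card V) Finset.univ (by simp) 0 le_rfl fun H φ hφ hφe =>
    Win.of_property fun H' hH => contains_mono hH
      ⟨⟨φ, by simpa [Set.injOn_univ] using hφ⟩, fun e he => hφe e he (Finset.subset_univ e)⟩
  simpa using this

/-! ### The threshold exponent -/

theorem exists_prob_contains_le {V : Type*} [Fintype V] [DecidableEq V]
    {G : UniformHypergraph V s} {d : ℕ} (hd : d ≠ 0) (hG : ¬ G.IsDegenerate (d - 1)) :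
    ∃ M : ℝ, 0 < M ∧ ∀ (n : ℕ) [NeZero n] (S : Strategy n s) (t : ℕ),
      prob S (Contains G n) t ≤ ENNReal.ofReal (n * (M * (n : ℝ)⁻¹ * t) ^ d) := by
  simp only [UniformHypergraph.IsDegenerate, not_forall, not_exists, not_and, not_le] at hG
  obtain ⟨W, F, hW, hFG, hFW, hdeg⟩ := hG
  refine ⟨(((1 + d * s) ^ W.card : ℕ) : ℝ), by positivity, fun n _ S t => ?_⟩
  refine (prob_contains_le (d := d) hW hFG hFW (fun v hv => ?_) S t).trans (le_of_eq ?_)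
  · have := hdeg v hv
    omega
  · have hn : (0 : ℝ) < n := by exact_mod_cast NeZero.pos n
    rw [ENNReal.ofReal_mul hn.le, ENNReal.ofReal_pow (by positivity),
      ENNReal.ofReal_mul (by positivity), ENNReal.ofReal_mul (by positivity),
      ENNReal.ofReal_inv_of_pos hn]
    simp only [ENNReal.ofReal_natCast]

theorem rpow_exponent_pow {x : ℝ} (hx : 0 < x) {d : ℕ} (hd : d ≠ 0) :
    x * ((x ^ (((d : ℝ) - 1) / d)) * x⁻¹) ^ d = 1 := by
  have hd' : (d : ℝ) ≠ 0 := by exact_mod_cast hd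
  rw [← Real.rpow_neg_one, ← Real.rpow_add hx, ← Real.rpow_natCast, ← Real.rpow_mul hx.le]
  have : (((d : ℝ) - 1) / d + -1) * d = -1 := by
    field_simp
    ring
  rw [this, Real.rpow_neg_one, mul_inv_cancel₀ hx.ne']

theorem le_optimalTime {V : Type*} [Fintype V] [DecidableEq V]
    {G : UniformHypergraph V s} {d : ℕ} (hd : d ≠ 0) (hG : ¬ G.IsDegenerate (d - 1)) {q : ℝ}
    (hq0 : 0 < q) (hq1 : q ≤ 1) :
    ∃ c : ℝ, 0 < c ∧ ∀ (n : ℕ) [NeZero n],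
      ENNReal.ofReal (c * (n : ℝ) ^ (((d : ℝ) - 1) / d)) ≤
        ((optimalTime s (Contains G n) q : ℕ∞) : ENNReal) := by
  obtain ⟨M, hM, hprob⟩ := exists_prob_contains_le hd hG
  -- With t below (q/M) n^((d-1)/d) the bound n (Mt/n)^d falls below q^d ≤ q.
  refine ⟨q / M, div_pos hq0 hM, fun n _ => ?_⟩
  have hn : (0 : ℝ) < n := by exact_mod_cast NeZero.pos n
  set x : ℝ := (n : ℝ) ^ (((d : ℝ) - 1) / d) with hx
  have hx0 : 0 < x := Real.rpow_pos_of_pos hn _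
  have key : (⌈q / M * x⌉₊ : ℕ∞) ≤ optimalTime s (Contains G n) q := by
    refine le_iInf fun S => le_iInf₂ fun t ht => ?_
    refine Nat.cast_le.2 (Nat.ceil_le.2 ?_)
    by_contra! hlt
    have h1 : q ≤ n * (M * (n : ℝ)⁻¹ * t) ^ d :=
      (ENNReal.ofReal_le_ofReal_iff (by positivity)).1 (le_trans ht (hprob n S t))
    have h2 : M * (n : ℝ)⁻¹ * t < q * (x * (n : ℝ)⁻¹) := by
      calc M * (n : ℝ)⁻¹ * t < M * (n : ℝ)⁻¹ * (q / M * x) :=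
            mul_lt_mul_of_pos_left hlt (by positivity)
        _ = q * (x * (n : ℝ)⁻¹) := by field_simp
    have h3 := mul_lt_mul_of_pos_left (pow_lt_pow_left₀ h2 (by positivity) hd) hn
    rw [mul_pow q, mul_left_comm (n : ℝ), rpow_exponent_pow hn hd, mul_one] at h3
    exact absurd (h1.trans_lt h3) (not_lt.2 (pow_le_of_le_one hq0.le hq1 hd))
  refine le_trans ?_ (ENat.toENNReal_le.2 key)
  rw [ENat.toENNReal_coe, ← ENNReal.ofReal_natCast]
  exact ENNReal.ofReal_le_ofReal (Nat.le_ceil _)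

theorem nonempty_reply (hs : s ≠ 0) (hn : s ≤ n) : Nonempty (Reply n s) := by
  obtain ⟨A, -, hA⟩ := Finset.exists_subset_card_eq (s := (Finset.univ : Finset (Fin n)))
    (n := s - 1) (by rw [Finset.card_univ, Fintype.card_fin]; omega)
  exact ⟨⟨A, by omega⟩⟩

theorem optimalTime_le {V : Type*} [Fintype V] [DecidableEq V] (hs : s ≠ 0)
    {G : UniformHypergraph V s} {d : ℕ} (hd : d ≠ 0) (hG : G.IsDegenerate d) {q : ℝ}
    (hq1 : q < 1) :
    ∃ C : ℝ, 0 < C ∧ ∃ N : ℕ, ∀ (n : ℕ) [NeZero n], N ≤ n →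
      ((optimalTime s (Contains G n) q : ℕ∞) : ENNReal) ≤
        ENNReal.ofReal (C * (n : ℝ) ^ (((d : ℝ) - 1) / d)) := by
  set k := Fintype.card V with hk
  have hq : 0 < 1 - q := sub_pos.2 hq1
  set C : ℝ := k * (d * 8) / (1 - q) with hC
  have hC0 : 0 ≤ C := by positivity
  -- The extra 1 absorbs rounding up to `T`, as x ≥ 1. In the threshold, `s` makes replies exist, `4
  -- ^ d` gives n^(1/d) ≥ 4, and `2 * k` leaves room for `k` vertices beside y^d ≤ n/2.
  refine ⟨C + 1, by positivity, s + 2 * k + 4 ^ d, fun n _ hn => ?_⟩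
  have h4d : 0 < 4 ^ d := by positivity
  have := nonempty_reply hs (show s ≤ n by omega)
  have hd' : (d : ℝ) ≠ 0 := by exact_mod_cast hd
  have hd1 : (1 : ℝ) ≤ d := by exact_mod_cast Nat.one_le_iff_ne_zero.2 hd
  have hn0 : (0 : ℝ) < n := by exact_mod_cast NeZero.pos n
  have hn1 : (1 : ℝ) ≤ n := by exact_mod_cast NeZero.pos n
  set x : ℝ := (n : ℝ) ^ (((d : ℝ) - 1) / d) with hx
  set r : ℝ := (n : ℝ) ^ ((d : ℝ)⁻¹) with hr
  have hx1 : 1 ≤ x := Real.one_le_rpow hn1 (div_nonneg (by linarith) (by linarith))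
  have hrd : r ^ d = n := Real.rpow_inv_natCast_pow hn0.le hd
  have hxr : x * r = n := by
    rw [hx, hr, ← Real.rpow_add hn0]
    have : ((d : ℝ) - 1) / d + (d : ℝ)⁻¹ = 1 := by
      field_simp
      ring
    rw [this, Real.rpow_one]
  have hr4 : 4 ≤ r := by
    refine le_of_pow_le_pow_left₀ hd (by positivity) ?_
    rw [hrd]
    exact_mod_cast (by omega : 4 ^ d ≤ n)
  -- Halving r = n^(1/d) gives 2 y^d ≤ n, while r ≥ 4 keeps y ≥ r/4, so that 2n/y ≤ 8 n^((d-1)/d).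
  set y := ⌊r / 2⌋₊ with hy
  have hy2 : 2 ≤ y := Nat.le_floor (by push_cast; linarith)
  have hyle : (y : ℝ) ≤ r / 2 := Nat.floor_le (by positivity)
  have hylt : r / 2 < y + 1 := Nat.lt_floor_add_one _
  have hyd : 2 * y ^ d ≤ n := by
    have h1 : (2 * (y : ℝ)) ^ d ≤ r ^ d := pow_le_pow_left₀ (by positivity) (by linarith) d
    rw [hrd, mul_pow] at h1
    have h2 : (2 : ℝ) ≤ 2 ^ d := le_self_pow₀ (by norm_num) hd
    have h3 : (2 : ℝ) * (y : ℝ) ^ d ≤ n :=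
      (mul_le_mul_of_nonneg_right h2 (by positivity)).trans h1
    exact_mod_cast h3
  have hwin := win_contains hG hy2 (n := n) (by omega)
  have hv : (k : ℝ) * (d * (2 * n / y)) ≤ C * x * (1 - q) := by
    have hy0 : (0 : ℝ) < y := by exact_mod_cast (by omega : 0 < y)
    have h1 : 2 * (n : ℝ) / y ≤ 8 * x := by
      rw [div_le_iff₀ hy0, ← hxr]
      nlinarith
    have h2 : C * x * (1 - q) = k * (d * (8 * x)) := by
      rw [hC]
      field_simp
    rw [h2]
    gcongr
  set T := ⌈C * x⌉₊ with hT
  have hT1 : C * x ≤ T := Nat.le_ceil _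
  have hT2 : (T : ℝ) < C * x + 1 := Nat.ceil_lt_add_one (by positivity)
  have hfail : failure s (Contains G n) T 0 ≤ 1 - q := by
    have h1 := (hwin 0 le_rfl T).trans hv
    have h2 : C * x * (1 - q) ≤ (1 - q) * (T + 1) := by nlinarith
    exact le_of_mul_le_mul_right (h1.trans h2) (by positivity)
  obtain ⟨S, hS⟩ := exists_strategy_one_sub_failure_le (s := s) (P := Contains G n)
    (fun H e hH => contains_mono (Multiset.le_cons_self _ _) hH) T
  have hle : optimalTime s (Contains G n) q ≤ (T : ℕ∞) :=
    (iInf_le _ S).trans (iInf₂_le T ((ENNReal.ofReal_le_ofReal (by linarith)).trans hS))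
  refine (ENat.toENNReal_le.2 hle).trans ?_
  rw [ENat.toENNReal_coe, ← ENNReal.ofReal_natCast]
  exact ENNReal.ofReal_le_ofReal (by nlinarith)

theorem tendsto_log_mul_rpow_div_log {c : ℝ} (hc : 0 < c) (α : ℝ) :
    Tendsto (fun n : ℕ => ENNReal.log (ENNReal.ofReal (c * ((n + 1 : ℕ) : ℝ) ^ α)) /
      ((Real.log ((n + 1 : ℕ) : ℝ) : ℝ) : EReal)) atTop (𝓝 (α : EReal)) := by
  have hlog : Tendsto (fun n : ℕ => Real.log ((n + 1 : ℕ) : ℝ)) atTop atTop :=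
    Real.tendsto_log_atTop.comp (tendsto_natCast_atTop_atTop.comp (tendsto_add_atTop_nat 1))
  have h1 : Tendsto (fun n : ℕ => Real.log c / Real.log ((n + 1 : ℕ) : ℝ) + α) atTop (𝓝 α) := by
    simpa using (hlog.const_div_atTop (Real.log c)).add_const α
  refine ((continuous_coe_real_ereal.tendsto α).comp h1).congr' ?_
  filter_upwards [hlog.eventually_gt_atTop 0] with n hn
  have hn0 : (0 : ℝ) < ((n + 1 : ℕ) : ℝ) := by positivity
  rw [ENNReal.log_ofReal_of_pos (by positivity), ← EReal.coe_div, Function.comp,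
    Real.log_mul hc.ne' (by positivity), Real.log_rpow hn0, add_div, mul_div_cancel_right₀ _ hn.ne']

theorem upperExponent_eq {V : Type*} [Fintype V] [DecidableEq V] (hs : s ≠ 0)
    {G : UniformHypergraph V s} {d : ℕ} (hd : d ≠ 0) (hG : G.IsDegenerate d)
    (hG' : ¬ G.IsDegenerate (d - 1)) {q : ℝ} (hq0 : 0 < q) (hq1 : q < 1) :
    upperExponent s (Contains G) q = ((((d : ℝ) - 1) / (d : ℝ) : ℝ) : EReal) := by
  obtain ⟨c, hc, hlow⟩ := le_optimalTime hd hG' hq0 hq1.le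
  obtain ⟨C, hC, N, hup⟩ := optimalTime_le hs hd hG hq1
  have hlog : ∀ n : ℕ, (0 : EReal) ≤ ((Real.log ((n + 1 : ℕ) : ℝ) : ℝ) : EReal) := fun n => by
    exact_mod_cast Real.log_natCast_nonneg (n + 1)
  refine Tendsto.limsup_eq (tendsto_of_tendsto_of_tendsto_of_le_of_le'
    (tendsto_log_mul_rpow_div_log hc _) (tendsto_log_mul_rpow_div_log hC _) ?_ ?_)
  · exact Eventually.of_forall fun n =>
      EReal.div_le_div_right_of_nonneg (hlog n) (ENNReal.log_monotone (hlow (n + 1)))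
  · filter_upwards [eventually_ge_atTop N] with n hn
    exact EReal.div_le_div_right_of_nonneg (hlog n)
      (ENNReal.log_monotone (hup (n + 1) (by omega)))

end SemiRandom

end

theorem mainTheorem5 {V : Type*} [Fintype V] [DecidableEq V] (s : ℕ) (hs : 2 ≤ s)
    (G : UniformHypergraph V s) (d : ℕ) (hd : 1 ≤ d) (hG : G.degeneracy = d) :
    SemiRandom.IsThresholdExponent s (SemiRandom.Contains G)
      ((((d : ℝ) - 1) / (d : ℝ) : ℝ) : EReal) := by
  have hdeg : G.IsDegenerate d := by
    -- The infimum of the empty set is 0, so a positive degeneracy is attained.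
    have := Nat.sInf_mem (Nat.nonempty_of_pos_sInf (s := {d | G.IsDegenerate d})
      (by change 0 < G.degeneracy; omega))
    rw [← hG]
    exact this
  have hdeg' : ¬ G.IsDegenerate (d - 1) :=
    Nat.notMem_of_lt_sInf (s := {d | G.IsDegenerate d}) (by change d - 1 < G.degeneracy; omega)
  refine tendsto_const_nhds.congr' ?_
  filter_upwards [Ioo_mem_nhdsLT (zero_lt_one' ℝ)] with q hq
  exact (SemiRandom.upperExponent_eq (by omega) (by omega) hdeg hdeg' hq.1 hq.2).symm
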